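/- Let $(a;q)_0=1$ and $(a;q)_k=\prod_{i=1}^{k}(1-aq^{i-1})$ for $k\ge 1$. Define the integers $v_0(n)$, $n\ge 0$, by the identity of formal power series $$\sum_{n=0}^\infty v_0(n)q^n=\sum_{k=0}^\infty \frac{q^{k^2}(-q;q^2)_k}{(q;q^2)_k}=\frac{V_0(q)+1}{2},$$ where $V_0(q)$ is the eighth order mock theta function of Gordon and McIntosh. Then for every integer $n\ge 0$, $$v_0(160n+68)\equiv v_0(160n+132)\equiv 0 \pmod{25}.$$ -/

import Mathlib

open PowerSeries
open scoped PowerSeries.WithPiTopology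

noncomputable section

/-- The finite `q`-shifted factorial `(a; q)_n = ∏_{i=1}^n (1 - a q^{i-1})`, for formal power
series `a` and `q` with integer coefficients. -/
def qPoch (a q : ℤ⟦X⟧) (n : ℕ) : ℤ⟦X⟧ :=
  ∏ i ∈ Finset.range n, (1 - a * q ^ i)

/-- The `k`-th summand `q^{k^2} (-q; q^2)_k / (q; q^2)_k`, with `q` the formal variable `X`.
The denominator has constant term `1`, and `invOfUnit _ 1` is its inverse in `ℤ⟦X⟧`. -/
def v0Term (k : ℕ) : ℤ⟦X⟧ :=
  X ^ (k ^ 2) * qPoch (-X) (X ^ 2) k * invOfUnit (qPoch X (X ^ 2) k) 1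

/-- The generating function `∑_{k ≥ 0} q^{k^2} (-q; q^2)_k / (q; q^2)_k = (V_0(q) + 1) / 2`, an
infinite sum of formal power series (coefficientwise convergence, `ℤ` discrete). -/
def v0Series : ℤ⟦X⟧ := ∑' k : ℕ, v0Term k

/-- `v_0(n)`: the coefficient of `q^n` in the generating function. -/
def v0 (n : ℕ) : ℤ := coeff n v0Series

end

theorem qPoch_mul_invOfUnit (k : ℕ) :
    qPoch X (X ^ 2) k * invOfUnit (qPoch X (X ^ 2) k) 1 = 1 := by
  apply mul_invOfUnit
  simp [qPoch, map_prod]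

theorem coeff_v0Term_of_lt {n k : ℕ} (h : n < k ^ 2) : coeff n (v0Term k) = 0 := by
  rw [v0Term, mul_assoc, coeff_X_pow_mul', if_neg (by omega)]

/-- The series defining `v0Series` converges, with the expected coefficients. -/
theorem hasSum_v0Term :
    HasSum v0Term
      (PowerSeries.mk fun n => ∑ k ∈ Finset.range (n + 1), coeff n (v0Term k)) := by
  rw [PowerSeries.WithPiTopology.hasSum_iff_hasSum_coeff]
  intro n
  rw [coeff_mk]
  apply hasSum_sum_of_ne_finset_zero
  intro k hk
  apply coeff_v0Term_of_lt
  rw [Finset.mem_range] at hk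
  nlinarith

theorem hasSum_v0Series : HasSum v0Term v0Series :=
  hasSum_v0Term.summable.hasSum

theorem v0_eq_sum (n : ℕ) : v0 n = ∑ k ∈ Finset.range (n + 1), coeff n (v0Term k) := by
  rw [v0, v0Series, hasSum_v0Term.tsum_eq, coeff_mk]

/-! Write φ(q) = ∑_{k∈ℤ} q^{k²} (`thetaSq 1`), ψ(q) = `thetaTri`, E_m = (q^m; q^m)_∞ and V =
`v0Series`. Letting k run over ℤ in the defining sum, the terms with k < 0 are those of V(-q), so
the bilateral sum is V(q) + V(-q) - 1. Up to a common factor, its k-th term is a product of two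
Euler-type series. Summing the resulting triple series over k first collapses it to a product, and
`evenGen_mul` follows: ∑ (2v₀(2n) - [n = 0]) q^n = φ(q)²/φ(-q²). Four 2-dissections with classical
identities for φ and ψ give `v0Gen_mul`: ∑ 2v₀(32n+4) q^n = 6ψ + 1024qψ⁹/φ(-q)⁸. Since ψ = E_2²/E_1
and φ(-q) = E_1²/E_2, the last term is 1024qE_2²⁶/E_1²⁵ (`eulerProd_pow_mul_v0Gen`). Modulo 25 it is
qE_2 times a series in q⁵. Exponents in ψ and in qE_2 are 0, 1 or 3 mod 5, so the classes 2 and 4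
vanish; these are the indices 160n+68 and 160n+132. -/

open Filter Topology

/-! ### Convergence of power series, coefficient by coefficient. -/

section Convergence

theorem summable_X_pow_mul {ι : Type*} (e : ι → ℕ) (he : ∀ n, {i | e i ≤ n}.Finite)
    (g : ι → ℤ⟦X⟧) : Summable fun i => X ^ e i * g i := by
  rw [WithPiTopology.summable_iff_summable_coeff]
  intro d
  refine summable_of_hasFiniteSupport ((he d).subset fun i hi => ?_)
  by_contra h
  simp only [Set.mem_ofPred_eq, not_le] at h
  exact hi (by simp [coeff_X_pow_mul', not_le.2 h])

theorem X_pow_dvd_of_hasSum {ι : Type*} {f : ι → ℤ⟦X⟧} {a : ℤ⟦X⟧} {n : ℕ}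
    (hf : HasSum f a) (h : ∀ i, X ^ n ∣ f i) : X ^ n ∣ a := by
  rw [X_pow_dvd_iff]
  intro m hm
  have h1 := (WithPiTopology.hasSum_iff_hasSum_coeff ℤ).1 hf m
  have h2 : (fun i => coeff m (f i)) = fun _ => 0 := by
    funext i
    exact X_pow_dvd_iff.1 (h i) m hm
  rw [h2] at h1
  exact h1.unique hasSum_zero

theorem tendsto_of_X_pow_dvd_sub {f : ℕ → ℤ⟦X⟧} {a : ℤ⟦X⟧} (h : ∀ n, X ^ n ∣ f n - a) :
    Tendsto f atTop (𝓝 a) := by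
  rw [WithPiTopology.tendsto_iff_coeff_tendsto]
  intro d
  refine tendsto_atTop_of_eventually_const (i₀ := d + 1) fun n hn => ?_
  have := X_pow_dvd_iff.1 (h n) d (by omega)
  rwa [map_sub, sub_eq_zero] at this

theorem X_pow_dvd_of_tendsto {f : ℕ → ℤ⟦X⟧} {a : ℤ⟦X⟧} {n : ℕ} (hf : Tendsto f atTop (𝓝 a))
    (h : ∀ᶠ m in atTop, X ^ n ∣ f m) : X ^ n ∣ a := by
  rw [X_pow_dvd_iff]
  intro m hm
  have h1 := (WithPiTopology.tendsto_iff_coeff_tendsto ℤ _ _ _).1 hf m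
  refine tendsto_nhds_unique h1 (tendsto_const_nhds.congr' ?_)
  filter_upwards [h] with i hi
  exact (X_pow_dvd_iff.1 hi m hm).symm

theorem continuous_expand (p : ℕ) (hp : p ≠ 0) :
    Continuous (expand p hp : ℤ⟦X⟧ → ℤ⟦X⟧) := by
  rw [continuous_iff_continuousAt]
  intro a
  rw [ContinuousAt, WithPiTopology.tendsto_iff_coeff_tendsto]
  intro d
  simp only [coeff_expand]
  split_ifs
  · exact (WithPiTopology.continuous_coeff ℤ _).tendsto a
  · exact tendsto_const_nhds

theorem hasSum_expand {ι : Type*} {f : ι → ℤ⟦X⟧} {a : ℤ⟦X⟧} (hf : HasSum f a) (p : ℕ)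
    (hp : p ≠ 0) : HasSum (fun i => expand p hp (f i)) (expand p hp a) :=
  hf.map (expand p hp) (continuous_expand p hp)

theorem expand_injective (p : ℕ) (hp : p ≠ 0) :
    Function.Injective (expand p hp : ℤ⟦X⟧ → ℤ⟦X⟧) := by
  intro a b h
  ext n
  have := congrArg (coeff (p * n)) h
  simpa using this

end Convergence

/-! ### Reciprocals of (q²; q²)_n. -/

section EvenPochhammer

noncomputable section

/-- The finite product `(q^2; q^2)_n`. -/
def evenPoch (n : ℕ) : ℤ⟦X⟧ := ∏ i ∈ Finset.range n, (1 - X ^ (2 * (i + 1)))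

/-- The inverse of `(q^2; q^2)_n`. -/
def evenPochInv (n : ℕ) : ℤ⟦X⟧ := invOfUnit (evenPoch n) 1

end

theorem evenPoch_mul_inv (n : ℕ) : evenPoch n * evenPochInv n = 1 := by
  apply mul_invOfUnit
  simp [evenPoch, map_prod]

theorem evenPochInv_zero : evenPochInv 0 = 1 := by
  simpa [evenPoch] using evenPoch_mul_inv 0

theorem evenPochInv_succ (n : ℕ) :
    evenPochInv (n + 1) * (1 - X ^ (2 * (n + 1))) = evenPochInv n := by
  have h := evenPoch_mul_inv n
  have h' := evenPoch_mul_inv (n + 1)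
  rw [evenPoch, Finset.prod_range_succ, ← evenPoch] at h'
  linear_combination evenPochInv n * h' - evenPochInv (n + 1) * (1 - X ^ (2 * (n + 1))) * h

end EvenPochhammer

/-! ### Euler's expansion of ∏ (1 + εq^{2i+1}) and its shifts. -/

section EulerSums

noncomputable section

/-- `∑_{j ≥ 0} ε^j q^{j^2 + 2mj} / (q^2; q^2)_j`. -/
def eulerSum (ε : ℤ⟦X⟧) (m : ℕ) : ℤ⟦X⟧ :=
  ∑' j : ℕ, X ^ (j ^ 2 + 2 * m * j) * (ε ^ j * evenPochInv j)

/-- `∑_{j ≥ 0} ε^j q^{(k - j)^2} / (q^2; q^2)_j`. -/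
def shiftedEulerSum (ε : ℤ⟦X⟧) (k : ℤ) : ℤ⟦X⟧ :=
  ∑' j : ℕ, X ^ ((k - j).natAbs ^ 2) * (ε ^ j * evenPochInv j)

/-- The finite product `∏_{i < n} (1 + ε q^{2i+1})`. -/
def oddProd (ε : ℤ⟦X⟧) (n : ℕ) : ℤ⟦X⟧ := ∏ i ∈ Finset.range n, (1 + ε * X ^ (2 * i + 1))

end

theorem hasSum_eulerSum (ε : ℤ⟦X⟧) (m : ℕ) :
    HasSum (fun j : ℕ => X ^ (j ^ 2 + 2 * m * j) * (ε ^ j * evenPochInv j)) (eulerSum ε m) :=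
  (summable_X_pow_mul _ (fun n => (Set.finite_Iic n).subset fun j (hj : _ ≤ n) => by
    simp only [Set.mem_Iic]
    nlinarith [Nat.zero_le (2 * m * j), Nat.le_self_pow two_ne_zero j]) _).hasSum

theorem finite_natAbs_sub_sq_le (k : ℤ) (n : ℕ) : {j : ℤ | (k - j).natAbs ^ 2 ≤ n}.Finite := by
  refine (Set.finite_Icc (k - n) (k + n)).subset fun j (hj : _ ≤ n) => ?_
  have := Nat.le_self_pow two_ne_zero (k - j).natAbs
  simp only [Set.mem_Icc]
  omega

theorem hasSum_shiftedEulerSum (ε : ℤ⟦X⟧) (k : ℤ) :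
    HasSum (fun j : ℕ => X ^ ((k - j).natAbs ^ 2) * (ε ^ j * evenPochInv j))
      (shiftedEulerSum ε k) :=
  (summable_X_pow_mul _ (fun n =>
    (finite_natAbs_sub_sq_le k n).preimage (f := ((↑) : ℕ → ℤ)) Nat.cast_injective.injOn) _).hasSum

/-- The difference of the two sums carries a factor 1 - q^{2j}, which cancels the last factor of
(q²; q²)_j; then j is shifted by one. -/
theorem eulerSum_succ (ε : ℤ⟦X⟧) (m : ℕ) :
    (1 + ε * X ^ (2 * m + 1)) * eulerSum ε (m + 1) = eulerSum ε m := by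
  have h1 := (hasSum_eulerSum ε m).sub (hasSum_eulerSum ε (m + 1))
  have h2 := (hasSum_eulerSum ε (m + 1)).mul_left (ε * X ^ (2 * m + 1))
  rw [← hasSum_nat_add_iff' 1] at h1
  have h3 := h1.unique (h2.congr_fun fun j => ?_)
  · simp [evenPochInv_zero] at h3
    linear_combination -h3
  · rw [← evenPochInv_succ j]
    ring

/-- Same cancellation as in `eulerSum_succ`, since (k-j)² + 2k + 1 = (k+1-j)² + 2j. -/
theorem shiftedEulerSum_succ (ε : ℤ⟦X⟧) (k : ℕ) :
    shiftedEulerSum ε (k + 1 : ℕ) = (ε + X ^ (2 * k + 1)) * shiftedEulerSum ε k := by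
  have h1 := (hasSum_shiftedEulerSum ε (k + 1 : ℕ)).sub
    ((hasSum_shiftedEulerSum ε k).mul_left (X ^ (2 * k + 1)))
  have h2 := (hasSum_shiftedEulerSum ε k).mul_left ε
  have key (j : ℕ) : 2 * k + 1 + ((k : ℤ) - j).natAbs ^ 2
      = (((k + 1 : ℕ) : ℤ) - j).natAbs ^ 2 + 2 * j := by
    zify
    simp only [sq_abs]
    ring
  rw [← hasSum_nat_add_iff' 1] at h1
  have h3 := h1.unique (h2.congr_fun fun j => ?_)
  · simp only [Finset.range_one, Finset.sum_singleton] at h3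
    rw [← mul_assoc (X ^ (2 * k + 1)), ← pow_add, key] at h3
    simp only [mul_zero, add_zero, sub_self, sub_zero] at h3
    linear_combination h3
  · rw [← mul_assoc (X ^ (2 * k + 1)), ← pow_add, key, ← evenPochInv_succ j]
    have : (((k + 1 : ℕ) : ℤ) - ((j + 1 : ℕ) : ℤ)) = k - j := by push_cast; ring
    rw [this]
    ring

theorem shiftedEulerSum_neg (ε : ℤ⟦X⟧) (m : ℕ) :
    shiftedEulerSum ε (-m) = X ^ (m ^ 2) * eulerSum ε m := by
  refine (hasSum_shiftedEulerSum ε (-m)).unique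
    (((hasSum_eulerSum ε m).mul_left (X ^ (m ^ 2))).congr_fun fun j => ?_)
  have : (-(m : ℤ) - j).natAbs ^ 2 = m ^ 2 + (j ^ 2 + 2 * m * j) := by
    zify
    simp only [sq_abs]
    ring
  rw [this, pow_add _ (m ^ 2), mul_assoc]

theorem shiftedEulerSum_zero (ε : ℤ⟦X⟧) : shiftedEulerSum ε 0 = eulerSum ε 0 := by
  simpa using shiftedEulerSum_neg ε 0

theorem oddProd_succ (ε : ℤ⟦X⟧) (n : ℕ) :
    oddProd ε (n + 1) = oddProd ε n * (1 + ε * X ^ (2 * n + 1)) := by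
  rw [oddProd, Finset.prod_range_succ, ← oddProd]

theorem oddProd_mul_eulerSum (ε : ℤ⟦X⟧) (n : ℕ) : oddProd ε n * eulerSum ε n = eulerSum ε 0 := by
  induction n with
  | zero => simp [oddProd]
  | succ n ih => rw [oddProd_succ, mul_assoc, eulerSum_succ, ih]

theorem shiftedEulerSum_natCast {ε : ℤ⟦X⟧} (hε : ε * ε = 1) (n : ℕ) :
    shiftedEulerSum ε n = ε ^ n * oddProd ε n * eulerSum ε 0 := by
  induction n with
  | zero => simp [oddProd, shiftedEulerSum_zero]
  | succ n ih =>
    rw [shiftedEulerSum_succ, ih, oddProd_succ]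
    linear_combination - ε ^ n * oddProd ε n * eulerSum ε 0 * X ^ (2 * n + 1) * hε

theorem X_pow_dvd_eulerSum_sub_one (ε : ℤ⟦X⟧) (n : ℕ) : X ^ n ∣ eulerSum ε n - 1 := by
  have h := hasSum_eulerSum ε n
  rw [← hasSum_nat_add_iff' 1] at h
  simp only [Finset.range_one, Finset.sum_singleton, evenPochInv_zero, pow_zero, mul_one, ne_eq,
    OfNat.ofNat_ne_zero, not_false_eq_true, zero_pow, mul_zero, add_zero] at h
  exact X_pow_dvd_of_hasSum h fun j => Dvd.dvd.mul_right (pow_dvd_pow X (by nlinarith)) _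

theorem tendsto_oddProd (ε : ℤ⟦X⟧) : Tendsto (oddProd ε) atTop (𝓝 (eulerSum ε 0)) := by
  refine tendsto_of_X_pow_dvd_sub fun n => ?_
  rw [← oddProd_mul_eulerSum ε n]
  have := (X_pow_dvd_eulerSum_sub_one ε n).mul_left (-oddProd ε n)
  convert this using 1
  ring

end EulerSums

/-! ### Jacobi's triple product at z = ±1. -/

section TripleProduct

noncomputable section

/-- Euler's product `(q; q)_∞`, given by its pentagonal number expansion. -/
abbrev eulerProd : ℤ⟦X⟧ := pentagonalSeries ℤ

/-- The dilation `f(q) ↦ f(q^2)`. -/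
abbrev dilate : ℤ⟦X⟧ →ₐ[ℤ] ℤ⟦X⟧ := expand 2 two_ne_zero

/-- The theta series `∑_{k ∈ ℤ} ε^k q^{k^2}`. -/
def thetaSq (ε : ℤ⟦X⟧) : ℤ⟦X⟧ := ∑' k : ℤ, X ^ (k.natAbs ^ 2) * ε ^ k.natAbs

end

theorem finite_natAbs_sq_le (n : ℕ) : {j : ℤ | j.natAbs ^ 2 ≤ n}.Finite := by
  simpa using finite_natAbs_sub_sq_le 0 n

theorem hasSum_thetaSq (ε : ℤ⟦X⟧) :
    HasSum (fun k : ℤ => X ^ (k.natAbs ^ 2) * ε ^ k.natAbs) (thetaSq ε) :=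
  (summable_X_pow_mul _ finite_natAbs_sq_le _).hasSum

theorem tendsto_prod_eulerProd :
    Tendsto (fun n => ∏ i ∈ Finset.range n, (1 - X ^ (i + 1) : ℤ⟦X⟧)) atTop (𝓝 eulerProd) :=
  (WithPiTopology.hasProd_one_sub_X_pow ℤ).tendsto_prod_nat

theorem dilate_prod (n : ℕ) :
    dilate (∏ i ∈ Finset.range n, (1 - X ^ (i + 1) : ℤ⟦X⟧)) = evenPoch n := by
  simp [evenPoch, map_prod, ← pow_mul]

theorem tendsto_evenPoch : Tendsto evenPoch atTop (𝓝 (dilate eulerProd)) :=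
  (((continuous_expand 2 two_ne_zero).tendsto _).comp tendsto_prod_eulerProd).congr dilate_prod

theorem prod_two_mul (n : ℕ) :
    ∏ i ∈ Finset.range (2 * n), (1 - X ^ (i + 1) : ℤ⟦X⟧) = evenPoch n * oddProd (-1) n := by
  induction n with
  | zero => simp [evenPoch, oddProd]
  | succ n ih =>
    rw [show 2 * (n + 1) = 2 * n + 1 + 1 by ring, Finset.prod_range_succ, Finset.prod_range_succ,
      ih, oddProd_succ, evenPoch, evenPoch, Finset.prod_range_succ]
    ring

theorem eulerProd_eq : eulerProd = dilate eulerProd * eulerSum (-1) 0 := by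
  refine tendsto_nhds_unique (tendsto_prod_eulerProd.comp
    (tendsto_id.const_mul_atTop' two_pos)) ?_
  exact (tendsto_evenPoch.mul (tendsto_oddProd (-1))).congr fun n => (prod_two_mul n).symm

theorem eulerSum_mul_eulerSum_neg :
    eulerSum 1 0 * eulerSum (-1) 0 = dilate (eulerSum (-1) 0) := by
  refine tendsto_nhds_unique ((tendsto_oddProd 1).mul (tendsto_oddProd (-1))) ?_
  refine (((continuous_expand 2 two_ne_zero).tendsto _).comp (tendsto_oddProd (-1))).congr
    fun n => ?_
  simp only [Function.comp_apply, oddProd, map_prod, ← Finset.prod_mul_distrib]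
  refine Finset.prod_congr rfl fun i _ => ?_
  simp only [map_add, map_mul, map_neg, map_one, map_pow, expand_X]
  ring

theorem constantCoeff_eulerProd : constantCoeff eulerProd = 1 := by
  have := coeff_pentagonalSeries_pentagonal ℤ 0
  simpa [pentagonal_def] using this

theorem X_pow_dvd_evenPoch_sub {m n : ℕ} (h : m ≤ n) :
    X ^ m ∣ evenPoch n - dilate eulerProd := by
  have h1 (k : ℕ) : X ^ m ∣ evenPoch (n + k) - evenPoch n := by
    induction k with
    | zero => simp
    | succ k ih =>
      rw [← add_assoc, evenPoch, Finset.prod_range_succ, ← evenPoch]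
      have : X ^ m ∣ evenPoch (n + k) * X ^ (2 * (n + k + 1)) :=
        Dvd.dvd.mul_left (pow_dvd_pow X (by omega)) _
      convert ih.sub this using 1
      ring
  refine X_pow_dvd_of_tendsto (tendsto_evenPoch.const_sub _) ?_
  filter_upwards [eventually_ge_atTop n] with k hk
  obtain ⟨j, rfl⟩ := Nat.exists_eq_add_of_le hk
  rw [dvd_sub_comm]
  exact h1 j

theorem X_pow_dvd_evenPochInv_sub {v : ℤ⟦X⟧} (hv : dilate eulerProd * v = 1) {m n : ℕ}
    (h : m ≤ n) : X ^ m ∣ evenPochInv n - v := by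
  have h1 := (X_pow_dvd_evenPoch_sub h).mul_left (-evenPochInv n * v)
  convert h1 using 1
  linear_combination (-evenPochInv n) * hv + v * evenPoch_mul_inv n

theorem pow_natAbs_add {ε : ℤ⟦X⟧} (hε : ε * ε = 1) (i : ℤ) (n j : ℕ) (h : i + n = j) :
    ε ^ n * ε ^ j = ε ^ i.natAbs := by
  have hpow (a : ℕ) : ε ^ (a + a) = 1 := by rw [← two_mul, pow_mul, pow_two, hε, one_pow]
  rw [← pow_add]
  rcases le_total 0 i with hi | hi
  · rw [show n + j = i.natAbs + (n + n) by omega, pow_add, hpow, mul_one]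
  · rw [show n + j = i.natAbs + (j + j) by omega, pow_add, hpow, mul_one]

/-- `shiftedEulerSum` at 2n, reindexed by i = j - 2n, is ∑ ε^i q^{i²}/(q²; q²)_{i+2n} up to sign. As
n grows, each denominator tends to (q²; q²)_∞. -/
theorem thetaSq_eq {ε : ℤ⟦X⟧} (hε : ε * ε = 1) :
    thetaSq ε = dilate eulerProd * eulerSum ε 0 ^ 2 := by
  set v : ℤ⟦X⟧ := invOfUnit (dilate eulerProd) 1
  have hv : dilate eulerProd * v = 1 := by
    apply mul_invOfUnit
    simp [constantCoeff_eulerProd]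
  suffices h : v * thetaSq ε = eulerSum ε 0 ^ 2 by
    rw [← h, ← mul_assoc, hv, one_mul]
  have hpow (n : ℕ) : ε ^ n * ε ^ n = 1 := by rw [← mul_pow, hε, one_pow]
  have key (n : ℕ) : X ^ n ∣ oddProd ε (2 * n) * eulerSum ε 0 - v * thetaSq ε := by
    have h1 : HasSum (fun j : ℕ => X ^ ((((2 * n : ℕ) : ℤ) - j).natAbs ^ 2) *
        (ε ^ (2 * n) * ε ^ j * evenPochInv j)) (oddProd ε (2 * n) * eulerSum ε 0) := by
      convert! (hasSum_shiftedEulerSum ε (2 * n : ℕ)).mul_left (ε ^ (2 * n)) using 1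
      · funext j
        ring
      · rw [shiftedEulerSum_natCast hε]
        linear_combination - oddProd ε (2 * n) * eulerSum ε 0 * hpow (2 * n)
    set F : ℤ → ℤ⟦X⟧ := fun i => X ^ (i.natAbs ^ 2) * (ε ^ i.natAbs *
      if 0 ≤ i + (2 * n : ℕ) then evenPochInv (i + (2 * n : ℕ)).toNat else 0) with hF
    have hinj : Function.Injective fun j : ℕ => (j : ℤ) - (2 * n : ℕ) := fun a b h => by
      simpa using h
    have h2 : HasSum F (oddProd ε (2 * n) * eulerSum ε 0) := by
      rw [← hinj.hasSum_iff]
      · refine h1.congr_fun fun j => ?_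
        simp only [Function.comp_apply, hF, sub_add_cancel, Nat.cast_nonneg, if_true,
          Int.toNat_natCast]
        rw [pow_natAbs_add hε ((j : ℤ) - (2 * n : ℕ)) (2 * n) j (by ring),
          show (((2 * n : ℕ) : ℤ) - j).natAbs = ((j : ℤ) - (2 * n : ℕ)).natAbs by omega]
      · intro i hi
        have : ¬ 0 ≤ i + (2 * n : ℕ) := fun h0 => hi ⟨(i + (2 * n : ℕ)).toNat, by
          simp only; omega⟩
        simp only [hF, if_neg this, mul_zero]
    refine X_pow_dvd_of_hasSum (h2.sub ((hasSum_thetaSq ε).mul_left v)) fun i => ?_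
    -- The shift 2n, rather than n, ensures that |i| < n leaves an index i + 2n ≥ n, where the
    -- reciprocal agrees with its limit up to q^n.
    by_cases hi : n ≤ i.natAbs
    · have h3 : (X : ℤ⟦X⟧) ^ n ∣ X ^ (i.natAbs ^ 2) :=
        pow_dvd_pow X (hi.trans (Nat.le_self_pow two_ne_zero _))
      exact (h3.mul_right _).sub ((h3.mul_right _).mul_left _)
    · have h4 : 0 ≤ i + (2 * n : ℕ) := by omega
      simp only [hF, if_pos h4]
      have h5 := (X_pow_dvd_evenPochInv_sub hv
        (show n ≤ (i + (2 * n : ℕ)).toNat by omega)).mul_left (X ^ (i.natAbs ^ 2) * ε ^ i.natAbs)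
      convert h5 using 1
      ring
  rw [eq_comm, pow_two]
  refine tendsto_nhds_unique (((tendsto_oddProd ε).comp
    (tendsto_id.const_mul_atTop' two_pos)).mul_const _) (tendsto_of_X_pow_dvd_sub key)

end TripleProduct

/-! ### Convolution of 1/(q²; q²)_n with its alternating twist. -/

section AltPochSum

noncomputable section

/-- The alternating sum `∑_{i + j = n} (-1)^i / ((q^2; q^2)_i (q^2; q^2)_j)`. -/
def altPochSum (n : ℕ) : ℤ⟦X⟧ :=
  ∑ p ∈ Finset.HasAntidiagonal.antidiagonal n, (-1) ^ p.1 * evenPochInv p.1 * evenPochInv p.2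

end

theorem mk_altPochSum :
    (mk altPochSum : ℤ⟦X⟧⟦X⟧) = rescale (-1) (mk evenPochInv) * mk evenPochInv := by
  ext1 n
  simp [coeff_mul, altPochSum, coeff_rescale]

/-- The outer variable z marks n. This is the functional equation (1 - z)P(z) = P(q²z) of P(z) =
1/(z; q²)_∞. -/
theorem one_sub_X_mul_mk_evenPochInv :
    (1 - X) * (mk evenPochInv : ℤ⟦X⟧⟦X⟧) = rescale (X ^ 2) (mk evenPochInv) := by
  ext1 n
  cases n with
  | zero => simp [sub_mul, coeff_rescale]
  | succ n =>
    rw [sub_mul, one_mul, map_sub, coeff_succ_X_mul, coeff_rescale, coeff_mk, coeff_mk,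
      ← evenPochInv_succ n]
    ring

/-- P(z)P(-z) = 1/(z²; q⁴)_∞, so only even powers of z survive, with coefficients 1/(q⁴; q⁴)_s. -/
theorem one_sub_X_sq_mul_mk_altPochSum :
    (1 - X ^ 2) * (mk altPochSum : ℤ⟦X⟧⟦X⟧) = rescale (X ^ 2) (mk altPochSum) := by
  have h := congrArg (rescale (-1 : ℤ⟦X⟧)) one_sub_X_mul_mk_evenPochInv
  rw [map_mul, map_sub, map_one, rescale_neg_one_X, rescale_rescale, mul_comm (X ^ 2 : ℤ⟦X⟧),
    ← rescale_rescale] at h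
  rw [mk_altPochSum, map_mul, ← one_sub_X_mul_mk_evenPochInv, ← h]
  ring

theorem altPochSum_add_two (n : ℕ) :
    altPochSum (n + 2) * (1 - X ^ (2 * (n + 2))) = altPochSum n := by
  have h := congrArg (coeff (n + 2)) one_sub_X_sq_mul_mk_altPochSum
  rw [sub_mul, one_mul, map_sub, add_comm n 2, coeff_X_pow_mul', if_pos (by omega), coeff_rescale,
    coeff_mk, coeff_mk, Nat.add_sub_cancel_left, ← pow_mul, add_comm 2 n] at h
  linear_combination h

theorem one_sub_X_pow_ne_zero (n : ℕ) : (1 - X ^ (n + 1) : ℤ⟦X⟧) ≠ 0 := fun h => by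
  simpa using congrArg constantCoeff h

theorem altPochSum_odd (s : ℕ) : altPochSum (2 * s + 1) = 0 := by
  induction s with
  | zero =>
    simp [altPochSum, Finset.Nat.antidiagonal_succ, evenPochInv_zero]
  | succ s ih =>
    have h := altPochSum_add_two (2 * s + 1)
    rw [ih] at h
    exact (mul_eq_zero.1 h).resolve_right (one_sub_X_pow_ne_zero _)

theorem altPochSum_even (s : ℕ) : altPochSum (2 * s) = dilate (evenPochInv s) := by
  induction s with
  | zero => simp [altPochSum, evenPochInv_zero]
  | succ s ih =>
    have h := altPochSum_add_two (2 * s)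
    rw [ih, ← evenPochInv_succ s] at h
    refine mul_right_cancel₀ (one_sub_X_pow_ne_zero (2 * (2 * s + 2) - 1)) (h.trans ?_)
    simp only [map_mul, map_sub, map_one, map_pow, expand_X, ← pow_mul]
    congr 3

end AltPochSum

/-! ### The bilateral sum and the even part of V₀. -/

section BilateralSum

noncomputable section

/-- The bilateral summand: up to a common factor, `q^{k^2} (-q; q^2)_k / (q; q^2)_k`. -/
def bilateralTerm (k : ℤ) : ℤ⟦X⟧ := shiftedEulerSum (-1) (-k) * shiftedEulerSum 1 k

/-- `∑_{k ∈ ℤ} q^{k^2 + (k - n)^2}`. -/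
def pairTheta (n : ℕ) : ℤ⟦X⟧ := ∑' k : ℤ, X ^ (k.natAbs ^ 2 + (k - n).natAbs ^ 2)

/-- The summand of the triple series expanding the sum of all `bilateralTerm k`. -/
def tripleTerm (t : ℤ × ℕ × ℕ) : ℤ⟦X⟧ :=
  X ^ ((-t.1 - t.2.1).natAbs ^ 2 + (t.1 - t.2.2).natAbs ^ 2) *
    ((-1) ^ t.2.1 * evenPochInv t.2.1 * evenPochInv t.2.2)

end

theorem summable_tripleTerm : Summable tripleTerm := by
  refine summable_X_pow_mul _ (fun n => ?_) _
  refine ((Set.finite_Icc (-(2 * n : ℤ)) (2 * n)).prod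
    ((Set.finite_Iic (2 * n)).prod (Set.finite_Iic (2 * n)))).subset ?_
  rintro ⟨k, i, j⟩ (h : _ ≤ n)
  have h1 := Nat.le_self_pow two_ne_zero (-k - i).natAbs
  have h2 := Nat.le_self_pow two_ne_zero (k - j).natAbs
  simp only [Set.mem_prod, Set.mem_Icc, Set.mem_Iic] at h ⊢
  omega

theorem hasSum_bilateralTerm : HasSum bilateralTerm (∑' t, tripleTerm t) := by
  refine summable_tripleTerm.hasSum.prod_fiberwise fun k => ?_
  have hsum : Summable fun p : ℕ × ℕ => tripleTerm (k, p) :=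
    summable_tripleTerm.comp_injective (Prod.mk_right_injective k)
  have hs : (fun p : ℕ × ℕ => X ^ ((-k - p.1).natAbs ^ 2) * ((-1 : ℤ⟦X⟧) ^ p.1 * evenPochInv p.1) *
      (X ^ ((k - p.2).natAbs ^ 2) * (1 ^ p.2 * evenPochInv p.2))) =
      fun p : ℕ × ℕ => tripleTerm (k, p) := by
    funext p
    simp only [tripleTerm, one_pow]
    ring
  have := (hasSum_shiftedEulerSum (-1) (-k)).mul (hasSum_shiftedEulerSum 1 k) (hs ▸ hsum)
  rwa [hs] at this

theorem finite_pair_sq_le (n m : ℕ) :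
    {k : ℤ | k.natAbs ^ 2 + (k - n).natAbs ^ 2 ≤ m}.Finite :=
  (finite_natAbs_sq_le m).subset fun _ (h : _ ≤ m) => le_trans (Nat.le_add_right _ _) h

theorem hasSum_pairTheta (n : ℕ) :
    HasSum (fun k : ℤ => X ^ (k.natAbs ^ 2 + (k - n).natAbs ^ 2)) (pairTheta n) := by
  simpa [pairTheta] using (summable_X_pow_mul _ (finite_pair_sq_le n) (fun _ => 1)).hasSum

/-- After k is translated by i, the exponent (k+i)² + (k-j)² depends on i and j only through n = i +
j. -/
theorem hasSum_altPochSum_mul_pairTheta :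
    HasSum (fun n => altPochSum n * pairTheta n) (∑' t, tripleTerm t) := by
  have h1 : HasSum (fun p : ℕ × ℕ => (-1) ^ p.1 * evenPochInv p.1 * evenPochInv p.2 *
      pairTheta (p.1 + p.2)) (∑' t, tripleTerm t) := by
    have := (Equiv.prodComm (ℕ × ℕ) ℤ).hasSum_iff.2 summable_tripleTerm.hasSum
    refine this.prod_fiberwise fun p => ?_
    have h2 := ((Equiv.addRight (p.1 : ℤ)).hasSum_iff.2
      (hasSum_pairTheta (p.1 + p.2))).mul_left ((-1) ^ p.1 * evenPochInv p.1 * evenPochInv p.2)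
    refine h2.congr_fun fun k => ?_
    simp only [Function.comp_apply, Equiv.prodComm_apply, Prod.swap_prod_mk, tripleTerm,
      Equiv.coe_addRight, Nat.cast_add]
    rw [show (-k - (p.1 : ℤ)).natAbs = (k + p.1).natAbs by omega,
      show k + (p.1 : ℤ) - (p.1 + p.2) = k - p.2 by ring, mul_comm]
  rw [← Finset.HasAntidiagonal.sigmaAntidiagonalEquivProd.hasSum_iff] at h1
  refine h1.sigma fun n => ?_
  have h3 := hasSum_fintype fun p : Finset.HasAntidiagonal.antidiagonal n =>
    (-1) ^ p.1.1 * evenPochInv p.1.1 * evenPochInv p.1.2 * pairTheta (p.1.1 + p.1.2)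
  convert! h3 using 1
  rw [altPochSum, Finset.sum_mul, ← Finset.sum_coe_sort]
  refine Finset.sum_congr rfl fun p _ => ?_
  rw [Finset.HasAntidiagonal.mem_antidiagonal.1 p.2]

theorem pairTheta_even (s : ℕ) :
    pairTheta (2 * s) = X ^ (2 * s ^ 2) * dilate (thetaSq 1) := by
  refine ((Equiv.addRight (s : ℤ)).hasSum_iff.2 (hasSum_pairTheta (2 * s))).unique
    (((hasSum_expand (hasSum_thetaSq 1) 2 two_ne_zero).mul_left (X ^ (2 * s ^ 2))).congr_fun
      fun k => ?_)
  simp only [Function.comp_apply, Equiv.coe_addRight, one_pow, mul_one, map_pow, expand_X,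
    ← pow_mul, ← pow_add]
  congr 1
  zify
  simp only [sq_abs]
  ring

theorem tsum_tripleTerm : ∑' t, tripleTerm t = dilate (thetaSq 1 * eulerSum 1 0) := by
  have hinj : Function.Injective fun s : ℕ => 2 * s := fun a b h => by simpa using h
  have h1 := hasSum_altPochSum_mul_pairTheta
  rw [← hinj.hasSum_iff] at h1
  · refine h1.unique ?_
    rw [map_mul]
    refine ((hasSum_expand (hasSum_eulerSum 1 0) 2 two_ne_zero).mul_left _).congr_fun fun s => ?_
    simp only [Function.comp_apply, altPochSum_even, pairTheta_even, map_mul, one_pow, one_mul,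
      map_pow, expand_X, mul_zero, zero_mul, add_zero, ← pow_mul]
    ring
  · intro n hn
    obtain ⟨s, rfl⟩ : Odd n := by
      rw [← Nat.not_even_iff_odd]
      rintro ⟨s, rfl⟩
      exact hn ⟨s, by simp only; ring⟩
    rw [altPochSum_odd, zero_mul]

theorem v0Term_mul_oddProd (k : ℕ) :
    v0Term k * oddProd (-1) k = X ^ k ^ 2 * oddProd 1 k := by
  have h := qPoch_mul_invOfUnit k
  have h1 : qPoch X (X ^ 2) k = oddProd (-1) k := by
    simp only [qPoch, oddProd]
    exact Finset.prod_congr rfl fun i _ => by ring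
  have h2 : qPoch (-X) (X ^ 2) k = oddProd 1 k := by
    simp only [qPoch, oddProd]
    exact Finset.prod_congr rfl fun i _ => by ring
  rw [v0Term, h2]
  rw [h1] at h ⊢
  linear_combination X ^ k ^ 2 * oddProd 1 k * h

theorem oddProd_ne_zero {ε : ℤ⟦X⟧} (n : ℕ) : oddProd ε n ≠ 0 := fun h => by
  simpa [oddProd, map_prod] using congrArg constantCoeff h

theorem bilateralTerm_natCast (n : ℕ) :
    bilateralTerm n = eulerSum 1 0 * eulerSum (-1) 0 * v0Term n := by
  refine mul_right_cancel₀ (oddProd_ne_zero (ε := -1) n) ?_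
  rw [bilateralTerm, shiftedEulerSum_neg, shiftedEulerSum_natCast (one_mul 1)]
  linear_combination X ^ n ^ 2 * oddProd 1 n * eulerSum 1 0 * oddProd_mul_eulerSum (-1) n
    - eulerSum 1 0 * eulerSum (-1) 0 * v0Term_mul_oddProd n

theorem rescale_oddProd (n : ℕ) : rescale (-1 : ℤ) (oddProd 1 n) = oddProd (-1) n := by
  simp only [oddProd, map_prod, map_add, map_one, one_mul, map_pow, rescale_neg_one_X]
  exact Finset.prod_congr rfl fun i _ => by rw [Odd.neg_pow ⟨i, rfl⟩]; ring

theorem bilateralTerm_neg_natCast (n : ℕ) :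
    bilateralTerm (-n) = eulerSum 1 0 * eulerSum (-1) 0 * rescale (-1 : ℤ) (v0Term n) := by
  refine mul_right_cancel₀ (oddProd_ne_zero (ε := 1) n) ?_
  have h := congrArg (rescale (-1 : ℤ)) (v0Term_mul_oddProd n)
  have h1 : rescale (-1 : ℤ) (oddProd (-1) n) = oddProd 1 n := by
    rw [← rescale_oddProd, rescale_rescale]
    simp
  rw [map_mul, map_mul, h1, rescale_oddProd, map_pow, rescale_neg_one_X, neg_pow, pow_two n,
    pow_mul, ← pow_two n] at h
  -- The sign from q ↦ -q in q^{n²} matches the ε^n of `shiftedEulerSum_natCast` at ε = -1.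
  have hs : ((-1 : ℤ⟦X⟧) ^ n) ^ n = (-1) ^ n := by
    rcases neg_one_pow_eq_or ℤ⟦X⟧ n with h | h <;> simp [h]
  rw [hs] at h
  rw [bilateralTerm, shiftedEulerSum_neg, neg_neg, shiftedEulerSum_natCast (by norm_num)]
  linear_combination X ^ n ^ 2 * (-1) ^ n * oddProd (-1) n * eulerSum (-1) 0 *
    oddProd_mul_eulerSum 1 n - eulerSum 1 0 * eulerSum (-1) 0 * h

theorem hasSum_rescale_v0Term :
    HasSum (fun n => rescale (-1 : ℤ) (v0Term n)) (rescale (-1 : ℤ) v0Series) := by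
  rw [WithPiTopology.hasSum_iff_hasSum_coeff]
  intro d
  simp only [coeff_rescale]
  exact ((WithPiTopology.hasSum_iff_hasSum_coeff ℤ).1 hasSum_v0Series d).mul_left _

theorem dilate_eulerSum_mul_v0Series :
    dilate (eulerSum (-1) 0) * (v0Series + rescale (-1 : ℤ) v0Series - 1) =
      dilate (thetaSq 1 * eulerSum 1 0) := by
  have h := (hasSum_v0Series.add hasSum_rescale_v0Term).mul_left
    (eulerSum 1 0 * eulerSum (-1) 0)
  -- Pairing n with -n counts k = 0 twice, hence the -1 in the statement.
  have h1 : HasSum (fun n : ℕ => eulerSum 1 0 * eulerSum (-1) 0 *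
      (v0Term n + rescale (-1 : ℤ) (v0Term n))) (∑' t, tripleTerm t + bilateralTerm 0) := by
    refine hasSum_bilateralTerm.nat_add_neg.congr_fun fun n => ?_
    rw [bilateralTerm_natCast, bilateralTerm_neg_natCast, mul_add]
  have h2 := h.unique h1
  have h3 : bilateralTerm 0 = eulerSum 1 0 * eulerSum (-1) 0 := by
    simp [bilateralTerm, shiftedEulerSum_zero, mul_comm]
  rw [h3, tsum_tripleTerm] at h2
  rw [← eulerSum_mul_eulerSum_neg]
  linear_combination h2

end BilateralSum

/-! ### Quadratic and quartic identities for φ and ψ. -/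

section ThetaIdentities

theorem hasSum_of_isCompl_range {ι κ κ' : Type*} {i : κ → ι} {j : κ' → ι}
    (hi : Function.Injective i) (hj : Function.Injective j)
    (h : IsCompl (Set.range i) (Set.range j)) {f : ι → ℤ⟦X⟧} {a b : ℤ⟦X⟧}
    (ha : HasSum (fun x => f (i x)) a) (hb : HasSum (fun x => f (j x)) b) : HasSum f (a + b) :=
  (hi.hasSum_range_iff.2 ha).add_isCompl h (hj.hasSum_range_iff.2 hb)

theorem isCompl_range_even_odd :
    IsCompl (Set.range fun a : ℤ => 2 * a) (Set.range fun a : ℤ => 2 * a + 1) := by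
  constructor
  · rw [Set.disjoint_left]
    rintro _ ⟨a, rfl⟩ ⟨b, h⟩
    simp only at h
    omega
  · rw [codisjoint_iff_le_sup]
    rintro x -
    rcases Int.even_or_odd' x with ⟨a, h | h⟩
    · exact Or.inl ⟨a, h.symm⟩
    · exact Or.inr ⟨a, h.symm⟩

theorem isCompl_range_parity :
    IsCompl (Set.range fun p : ℤ × ℤ => (p.1 + p.2, p.1 - p.2))
      (Set.range fun p : ℤ × ℤ => (p.1 + p.2, p.1 - p.2 - 1)) := by
  constructor
  · rw [Set.disjoint_left]
    rintro _ ⟨⟨a, b⟩, rfl⟩ ⟨⟨c, d⟩, h⟩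
    simp only [Prod.mk.injEq] at h
    omega
  · rw [codisjoint_iff_le_sup]
    rintro ⟨m, n⟩ -
    rcases Int.even_or_odd' (m + n) with ⟨a, h | h⟩
    · exact Or.inl ⟨(a, m - a), by simp only [Prod.mk.injEq]; omega⟩
    · exact Or.inr ⟨(a + 1, m - a - 1), by simp only [Prod.mk.injEq]; omega⟩

/-- The triangular number `k (k + 1) / 2` of an integer. -/
def triangle (k : ℤ) : ℕ := (k * (k + 1) / 2).toNat

theorem two_mul_triangle (k : ℤ) : 2 * (triangle k : ℤ) = k * (k + 1) := by
  have h : 0 ≤ k * (k + 1) := by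
    rcases le_or_gt 0 k with h | h
    · positivity
    · exact mul_nonneg_of_nonpos_of_nonpos h.le (by omega)
  rw [triangle, Int.toNat_of_nonneg (Int.ediv_nonneg h two_pos.le)]
  exact Int.mul_ediv_cancel' (Int.even_mul_succ_self k).two_dvd

theorem triangle_neg (k : ℤ) : triangle (-(k + 1)) = triangle k := by
  zify
  linarith [two_mul_triangle k, two_mul_triangle (-(k + 1))]

noncomputable section

/-- Ramanujan's theta series `ψ(q) = ∑_{n ≥ 0} q^{n(n+1)/2}`. -/
def thetaTri : ℤ⟦X⟧ := ∑' n : ℕ, X ^ triangle n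

end

theorem le_triangle (n : ℕ) : n ≤ triangle n := by
  have := two_mul_triangle n
  zify
  nlinarith [sq_nonneg ((n : ℤ) - 1), Int.natCast_nonneg n, Int.le_self_sq n]

theorem hasSum_thetaTri : HasSum (fun n : ℕ => (X : ℤ⟦X⟧) ^ triangle n) thetaTri := by
  simpa [thetaTri] using (summable_X_pow_mul (fun n : ℕ => triangle n)
    (fun n => (Set.finite_Iic n).subset fun j hj => (le_triangle j).trans hj) (fun _ => 1)).hasSum

theorem hasSum_int_thetaTri :
    HasSum (fun k : ℤ => (X : ℤ⟦X⟧) ^ triangle k) (2 * thetaTri) := by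
  rw [two_mul]
  refine HasSum.of_nat_of_neg_add_one hasSum_thetaTri ?_
  simpa only [triangle_neg] using hasSum_thetaTri

theorem thetaSq_dissection {ε : ℤ⟦X⟧} (hε : ε * ε = 1) :
    thetaSq ε = dilate (dilate (thetaSq 1)) +
      2 * ε * X * dilate (dilate (dilate thetaTri)) := by
  have hpow (n : ℕ) : ε ^ (2 * n) = 1 := by rw [pow_mul, pow_two, hε, one_pow]
  refine (hasSum_thetaSq ε).unique (hasSum_of_isCompl_range (fun a b h => ?_) (fun a b h => ?_)
    isCompl_range_even_odd ?_ ?_)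
  · simpa using h
  · simpa using h
  · refine (hasSum_expand (hasSum_expand (hasSum_thetaSq 1) 2 two_ne_zero) 2
      two_ne_zero).congr_fun fun k => ?_
    rw [Int.natAbs_mul, show (2 : ℤ).natAbs = 2 from rfl, hpow]
    simp only [one_pow, mul_one, map_pow, expand_X, ← pow_mul]
    congr 1
    ring
  · have h := (hasSum_expand (hasSum_expand (hasSum_expand hasSum_int_thetaTri 2 two_ne_zero) 2
      two_ne_zero) 2 two_ne_zero).mul_left (ε * X)
    convert! h using 1
    · funext k
      have h1 : ((2 * k + 1).natAbs ^ 2 : ℕ) = 1 + 8 * triangle k := by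
        zify
        rw [sq_abs]
        linear_combination -4 * two_mul_triangle k
      have h2 : ε ^ (2 * k + 1).natAbs = ε := by
        rw [show (2 * k + 1).natAbs = 2 * ((2 * k + 1).natAbs / 2) + 1 by omega, pow_succ, hpow,
          one_mul]
      rw [h1, h2]
      simp only [map_pow, expand_X, ← pow_mul]
      rw [pow_add]
      ring
    · simp only [map_mul, map_ofNat]
      ring

theorem hasSum_X_pow_mul_prod {e e' : ℤ → ℕ} {a b : ℤ⟦X⟧} (he : ∀ n, {i | e i ≤ n}.Finite)
    (he' : ∀ n, {i | e' i ≤ n}.Finite) (ha : HasSum (fun k : ℤ => (X : ℤ⟦X⟧) ^ e k) a)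
    (hb : HasSum (fun k : ℤ => (X : ℤ⟦X⟧) ^ e' k) b) :
    HasSum (fun p : ℤ × ℤ => (X : ℤ⟦X⟧) ^ (e p.1 + e' p.2)) (a * b) := by
  have := summable_X_pow_mul (fun p : ℤ × ℤ => e p.1 + e' p.2) (fun n =>
    ((he n).prod (he' n)).subset fun p (hp : _ ≤ n) =>
      ⟨(Nat.le_add_right _ _).trans hp, (Nat.le_add_left _ _).trans hp⟩) (fun _ => 1)
  simp only [mul_one, pow_add] at this
  simpa only [pow_add] using ha.mul hb this

theorem hasSum_dilate_X_pow {ι : Type*} {e : ι → ℕ} {a : ℤ⟦X⟧}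
    (ha : HasSum (fun k => (X : ℤ⟦X⟧) ^ e k) a) :
    HasSum (fun k => (X : ℤ⟦X⟧) ^ (2 * e k)) (dilate a) := by
  simpa only [map_pow, expand_X, ← pow_mul] using hasSum_expand ha 2 two_ne_zero

theorem hasSum_of_parity {f : ℤ × ℤ → ℤ⟦X⟧} {a b : ℤ⟦X⟧}
    (ha : HasSum (fun p : ℤ × ℤ => f (p.1 + p.2, p.1 - p.2)) a)
    (hb : HasSum (fun p : ℤ × ℤ => f (p.1 + p.2, p.1 - p.2 - 1)) b) : HasSum f (a + b) := by
  refine hasSum_of_isCompl_range (fun a b h => ?_) (fun a b h => ?_) isCompl_range_parity ha hb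
  all_goals
    simp only [Prod.mk.injEq] at h
    ext <;> omega

theorem finite_triangle_le (n : ℕ) : {k : ℤ | triangle k ≤ n}.Finite := by
  refine (Set.finite_Icc (-(n + 1 : ℤ)) n).subset fun k (hk : _ ≤ n) => ?_
  rw [Set.mem_Icc]
  have h : (triangle k : ℤ) ≤ n := by exact_mod_cast hk
  rcases le_or_gt 0 k with h0 | h0
  · lift k to ℕ using h0
    have := le_triangle k
    omega
  · obtain ⟨j, rfl⟩ := Int.eq_negSucc_of_lt_zero h0
    rw [Int.negSucc_eq] at hk ⊢
    rw [triangle_neg] at hk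
    have := le_triangle j
    omega

theorem hasSum_thetaSq_one : HasSum (fun k : ℤ => (X : ℤ⟦X⟧) ^ (k.natAbs ^ 2)) (thetaSq 1) := by
  simpa using hasSum_thetaSq 1

/-- The lattice sum over (m, n) is split by the parity of m + n: the even class gives 2a² + 2b², the
odd class 1 + 4T(a-1) + 4T(b), with T = `triangle`. -/
theorem thetaSq_sq :
    thetaSq 1 ^ 2 = dilate (thetaSq 1) ^ 2 + 4 * X * dilate (dilate thetaTri) ^ 2 := by
  have hT (p : ℤ) := two_mul_triangle p
  have h0 := hasSum_X_pow_mul_prod finite_natAbs_sq_le finite_natAbs_sq_le hasSum_thetaSq_one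
    hasSum_thetaSq_one
  have h1 : HasSum (fun k : ℤ => (X : ℤ⟦X⟧) ^ triangle (k - 1)) (2 * thetaTri) :=
    (Equiv.subRight (1 : ℤ)).hasSum_iff (f := fun k : ℤ => (X : ℤ⟦X⟧) ^ triangle k) |>.2
      hasSum_int_thetaTri
  have hfin (n : ℕ) : {k : ℤ | triangle (k - 1) ≤ n}.Finite :=
    ((finite_triangle_le n).image (· + 1)).subset fun k hk => ⟨k - 1, hk, by simp⟩
  have h2 := (hasSum_dilate_X_pow (hasSum_dilate_X_pow
    (hasSum_X_pow_mul_prod hfin finite_triangle_le h1 hasSum_int_thetaTri))).mul_left X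
  have h3 : HasSum (fun p : ℤ × ℤ => (X : ℤ⟦X⟧) ^ ((p.1 + p.2).natAbs ^ 2 +
      (p.1 - p.2).natAbs ^ 2)) (dilate (thetaSq 1 * thetaSq 1)) := by
    refine (hasSum_dilate_X_pow h0).congr_fun fun p => ?_
    congr 1
    zify
    simp only [sq_abs]
    ring
  have h4 : HasSum (fun p : ℤ × ℤ => (X : ℤ⟦X⟧) ^ ((p.1 + p.2).natAbs ^ 2 +
      (p.1 - p.2 - 1).natAbs ^ 2))
      (X * dilate (dilate (2 * thetaTri * (2 * thetaTri)))) := by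
    refine h2.congr_fun fun p => ?_
    rw [← pow_succ']
    congr 1
    zify
    simp only [sq_abs]
    linear_combination -2 * hT (p.1 - 1) - 2 * hT p.2
  have h5 := h0.unique (hasSum_of_parity
    (f := fun p : ℤ × ℤ => X ^ (p.1.natAbs ^ 2 + p.2.natAbs ^ 2)) h3 h4)
  simp only [map_mul, map_ofNat] at h5
  linear_combination h5

/-- Under the same parity split, both classes give a square plus twice a triangular number, hence
equal contributions. -/
theorem thetaTri_sq : thetaTri ^ 2 = thetaSq 1 * dilate thetaTri := by
  have hT (p : ℤ) := two_mul_triangle p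
  have h0 := hasSum_X_pow_mul_prod finite_triangle_le finite_triangle_le hasSum_int_thetaTri
    hasSum_int_thetaTri
  have hfin (n : ℕ) : {k : ℤ | 2 * triangle k ≤ n}.Finite :=
    (finite_triangle_le n).subset fun k (hk : _ ≤ n) => by
      simp only [Set.mem_ofPred_eq]
      omega
  have hd := hasSum_dilate_X_pow hasSum_int_thetaTri
  have h1 := hasSum_X_pow_mul_prod hfin finite_natAbs_sq_le hd hasSum_thetaSq_one
  have h2 := hasSum_X_pow_mul_prod finite_natAbs_sq_le hfin hasSum_thetaSq_one hd
  have h3 : HasSum (fun p : ℤ × ℤ => (X : ℤ⟦X⟧) ^ (triangle (p.1 + p.2) +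
      triangle (p.1 - p.2))) (dilate (2 * thetaTri) * thetaSq 1) := by
    refine h1.congr_fun fun p => ?_
    congr 1
    zify
    simp only [sq_abs]
    refine mul_left_cancel₀ (two_ne_zero (α := ℤ)) ?_
    linear_combination hT (p.1 + p.2) + hT (p.1 - p.2) - 2 * hT p.1
  have h4 : HasSum (fun p : ℤ × ℤ => (X : ℤ⟦X⟧) ^ (triangle (p.1 + p.2) +
      triangle (p.1 - p.2 - 1))) (thetaSq 1 * dilate (2 * thetaTri)) := by
    refine h2.congr_fun fun p => ?_
    congr 1
    zify
    simp only [sq_abs]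
    refine mul_left_cancel₀ (two_ne_zero (α := ℤ)) ?_
    linear_combination hT (p.1 + p.2) + hT (p.1 - p.2 - 1) - 2 * hT p.2
  have h5 := h0.unique (hasSum_of_parity
    (f := fun p : ℤ × ℤ => X ^ (triangle p.1 + triangle p.2)) h3 h4)
  simp only [map_mul, map_ofNat] at h5
  refine mul_left_cancel₀ (show (4 : ℤ⟦X⟧) ≠ 0 from fun h => by
    simpa [map_ofNat] using (map_ofNat constantCoeff 4).symm.trans (congrArg constantCoeff h)) ?_
  linear_combination h5

theorem thetaSq_mul_thetaSq_neg :
    thetaSq 1 * thetaSq (-1) = dilate (thetaSq (-1)) ^ 2 := by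
  have h := congrArg dilate eulerProd_eq
  rw [map_mul, ← eulerSum_mul_eulerSum_neg] at h
  rw [thetaSq_eq (one_mul 1), thetaSq_eq (ε := -1) (by norm_num), map_mul, map_pow,
    ← eulerSum_mul_eulerSum_neg]
  linear_combination (eulerSum 1 0 * eulerSum (-1) 0) ^ 2 * (dilate eulerProd +
    dilate (dilate eulerProd) * (eulerSum 1 0 * eulerSum (-1) 0)) * h

theorem thetaSq_neg_sq :
    thetaSq (-1) ^ 2 = dilate (thetaSq 1) ^ 2 - 4 * X * dilate (dilate thetaTri) ^ 2 := by
  have h1 := thetaSq_dissection (one_mul (1 : ℤ⟦X⟧))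
  have h2 := thetaSq_dissection (show (-1 : ℤ⟦X⟧) * -1 = 1 by norm_num)
  have h3 := congrArg (fun f => dilate (dilate f)) thetaTri_sq
  simp only [map_mul, map_pow] at h3
  have h4 := thetaSq_sq
  set x := dilate (dilate (thetaSq 1))
  set y := dilate (dilate (dilate thetaTri))
  linear_combination h4 + 8 * X * h3 + (thetaSq (-1) + x - 2 * X * y) * h2
    - (thetaSq 1 + x + 2 * X * y) * h1

theorem thetaSq_neg_pow_four :
    thetaSq (-1) ^ 4 = thetaSq 1 ^ 4 - 16 * X * dilate thetaTri ^ 4 := by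
  have h1 := thetaSq_sq
  have h2 := thetaSq_neg_sq
  have h3 := congrArg dilate thetaTri_sq
  simp only [map_mul, map_pow] at h3
  set y := dilate (dilate thetaTri)
  linear_combination (thetaSq (-1) ^ 2 + dilate (thetaSq 1) ^ 2 - 4 * X * y ^ 2) * h2
    - (thetaSq 1 ^ 2 + dilate (thetaSq 1) ^ 2 + 4 * X * y ^ 2) * h1
    + 16 * X * (dilate thetaTri ^ 2 + dilate (thetaSq 1) * y) * h3

/-- If f ≠ 1 and f - 1 has order m > 0, then (f - 1)(f + 1) also has order m, while f(q²) - 1 has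
order 2m. -/
theorem eq_one_of_sq_eq_dilate {f : ℤ⟦X⟧} (h0 : constantCoeff f = 1) (h : f ^ 2 = dilate f) :
    f = 1 := by
  by_contra hne
  have h1 : (f - 1) * (f + 1) = dilate (f - 1) := by
    rw [map_sub, map_one]
    linear_combination h
  have h2 : (f + 1).order = 0 := by
    by_contra h2
    rw [← ne_eq, order_ne_zero_iff_constCoeff_eq_zero, map_add, h0] at h2
    simp at h2
  have h3 : (f - 1).order ≠ 0 := by
    rw [order_ne_zero_iff_constCoeff_eq_zero, map_sub, h0]
    simp
  have h4 : (f - 1).order ≠ ⊤ := by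
    rw [ne_eq, order_eq_top, sub_eq_zero]
    exact hne
  have h5 := congrArg order h1
  rw [order_mul, h2, order_expand, add_zero] at h5
  lift (f - 1).order to ℕ using h4 with m
  rw [two_nsmul] at h5
  norm_cast at h3 h5
  omega

end ThetaIdentities

/-! ### Gauss's products for ψ(q) and φ(-q). -/

section ProductFormulas

theorem constantCoeff_thetaTri : constantCoeff thetaTri = 1 := by
  have h1 := (WithPiTopology.hasSum_iff_hasSum_coeff ℤ).1 hasSum_thetaTri 0
  rw [coeff_zero_eq_constantCoeff_apply] at h1
  refine h1.unique ((hasSum_ite_eq (0 : ℕ) (1 : ℤ)).congr_fun fun n => ?_)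
  have := le_triangle n
  rcases eq_or_ne n 0 with rfl | hn
  · simp [triangle]
  · rw [coeff_X_pow, if_neg (by omega), if_neg hn]

/-- By `thetaTri_sq`, the quotient f = ψE_1/E_2² satisfies f(q)² = f(q²), so
`eq_one_of_sq_eq_dilate` applies. -/
theorem thetaTri_mul_eulerProd : thetaTri * eulerProd = dilate eulerProd ^ 2 := by
  set v : ℤ⟦X⟧ := invOfUnit (dilate eulerProd) 1
  have hv : dilate eulerProd * v = 1 := by
    apply mul_invOfUnit
    simp [constantCoeff_eulerProd]
  have hv0 : constantCoeff v = 1 := by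
    simpa [constantCoeff_eulerProd] using congrArg constantCoeff hv
  have h1 := eulerProd_eq
  have h2 := congrArg dilate eulerProd_eq
  rw [map_mul, ← eulerSum_mul_eulerSum_neg] at h2
  have h3 := thetaTri_sq
  rw [thetaSq_eq (one_mul 1)] at h3
  have h4 := congrArg dilate hv
  rw [map_mul, map_one] at h4
  have h : thetaTri * eulerProd * v ^ 2 = 1 := by
    refine eq_one_of_sq_eq_dilate ?_ ?_
    · simp [constantCoeff_thetaTri, constantCoeff_eulerProd, hv0]
    · set e1 := dilate eulerProd
      set e2 := dilate e1
      set p := eulerSum 1 0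
      set m := eulerSum (-1) 0
      simp only [map_mul, map_pow]
      have h5 : (thetaTri * eulerProd) ^ 2 * e2 ^ 2 = e1 ^ 4 * (dilate thetaTri * e1) := by
        rw [mul_pow, h3, h1]
        linear_combination (-(e1 ^ 3 * dilate thetaTri) * (e1 + e2 * (p * m))) * h2
      have hv4 : e1 ^ 4 * v ^ 4 = 1 := by rw [← mul_pow, hv, one_pow]
      have hw2 : e2 ^ 2 * dilate v ^ 2 = 1 := by rw [← mul_pow, h4, one_pow]
      linear_combination v ^ 4 * dilate v ^ 2 * h5 + dilate thetaTri * e1 * dilate v ^ 2 * hv4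
        - (thetaTri * eulerProd) ^ 2 * v ^ 4 * hw2
  linear_combination dilate eulerProd ^ 2 * h -
    thetaTri * eulerProd * (dilate eulerProd * v + 1) * hv

theorem thetaSq_neg_mul_eulerProd : thetaSq (-1) * dilate eulerProd = eulerProd ^ 2 := by
  rw [thetaSq_eq (ε := -1) (by norm_num)]
  have := eulerProd_eq
  linear_combination (-(dilate eulerProd * eulerSum (-1) 0 + eulerProd)) * this

end ProductFormulas

/-! ### Repeated 2-dissection down to 32n + 4. -/

section Dissection

theorem dilate_add_X_mul_dilate_inj {a b c d : ℤ⟦X⟧}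
    (h : dilate a + X * dilate b = dilate c + X * dilate d) : a = c ∧ b = d := by
  have h0 (f g : ℤ⟦X⟧) (n : ℕ) : coeff (2 * n) (dilate f + X * dilate g) = coeff n f := by
    rw [map_add, coeff_expand_mul, add_eq_left]
    cases n with
    | zero => simp
    | succ n =>
      rw [mul_add, mul_one, coeff_succ_X_mul, coeff_expand_of_not_dvd]
      omega
  have h1 (f g : ℤ⟦X⟧) (n : ℕ) : coeff (2 * n + 1) (dilate f + X * dilate g) = coeff n g := by
    rw [map_add, coeff_succ_X_mul, coeff_expand_mul, coeff_expand_of_not_dvd _ _ _ (by omega),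
      zero_add]
  constructor <;> ext n
  · rw [← h0 a b, h, h0]
  · rw [← h1 a b, h, h1]

theorem eq_dilate_add_X_mul_dilate (f : ℤ⟦X⟧) :
    f = dilate (mk fun n => coeff (2 * n) f) + X * dilate (mk fun n => coeff (2 * n + 1) f) := by
  ext n
  rcases Nat.even_or_odd' n with ⟨k, rfl | rfl⟩
  · rw [map_add, coeff_expand_mul, coeff_mk, eq_comm, add_eq_left]
    cases k with
    | zero => simp
    | succ k =>
      rw [mul_add, mul_one, coeff_succ_X_mul, coeff_expand_of_not_dvd]
      omega
  · rw [map_add, coeff_succ_X_mul, coeff_expand_mul, coeff_expand_of_not_dvd _ _ _ (by omega),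
      zero_add, coeff_mk]

theorem dissect_mul_dilate {f m c d : ℤ⟦X⟧} (h : f * dilate m = dilate c + X * dilate d) :
    (mk fun n => coeff (2 * n) f) * m = c ∧ (mk fun n => coeff (2 * n + 1) f) * m = d := by
  apply dilate_add_X_mul_dilate_inj
  rw [← h]
  conv_rhs => rw [eq_dilate_add_X_mul_dilate f]
  simp only [map_mul]
  ring

noncomputable section

/-- `∑ (2 v₀(2n) - [n = 0]) q^n`, the even part of the eighth order mock theta function `V₀`. -/
def evenGen : ℤ⟦X⟧ := mk fun n => coeff (2 * n) (v0Series + rescale (-1 : ℤ) v0Series - 1)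

/-- `∑ 2 v₀(32n + 4) q^n`. -/
def v0Gen : ℤ⟦X⟧ := mk fun n => 2 * v0 (32 * n + 4)

end

theorem dilate_evenGen : dilate evenGen = v0Series + rescale (-1 : ℤ) v0Series - 1 := by
  rw [eq_dilate_add_X_mul_dilate (v0Series + _ - 1), ← evenGen, eq_comm, add_eq_left]
  refine mul_eq_zero_of_right _ ?_
  rw [map_eq_zero_iff _ (expand_injective 2 two_ne_zero)]
  ext n
  rw [coeff_mk, map_sub, map_add, coeff_rescale, coeff_one, if_neg (by omega),
    Odd.neg_one_pow ⟨n, rfl⟩, map_zero]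
  ring

theorem evenGen_mul : evenGen * dilate (thetaSq (-1)) = thetaSq 1 ^ 2 := by
  have h := dilate_eulerSum_mul_v0Series
  rw [← dilate_evenGen, ← map_mul] at h
  have h1 := expand_injective 2 two_ne_zero h
  have h2 := congrArg dilate eulerProd_eq
  rw [map_mul, ← eulerSum_mul_eulerSum_neg] at h2
  rw [thetaSq_eq (ε := -1) (by norm_num), map_mul, map_pow, ← eulerSum_mul_eulerSum_neg]
  have h3 := thetaSq_eq (one_mul (1 : ℤ⟦X⟧))
  set p := eulerSum 1 0
  set m := eulerSum (-1) 0
  linear_combination dilate eulerProd * p * h1 - thetaSq 1 * h3 - evenGen * p * m * h2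

theorem coeff_evenGen (n : ℕ) : coeff (16 * n + 2) evenGen = 2 * v0 (32 * n + 4) := by
  rw [evenGen, coeff_mk, show 2 * (16 * n + 2) = 32 * n + 4 by ring, map_sub, map_add,
    coeff_rescale, coeff_one, if_neg (by omega), Even.neg_one_pow ⟨16 * n + 2, by ring⟩, v0]
  ring

/-- Before each later dissection, a power of φ is multiplied in: φ(q)φ(-q) = φ(-q²)² makes the
denominator a series in q². Taking even, odd, even, even parts selects index 16n + 2 of `evenGen`.
-/
theorem v0Gen_mul :
    v0Gen * thetaSq (-1) ^ 8 =
      thetaTri * (6 * thetaSq (-1) ^ 8 + 1024 * X * thetaTri ^ 8) := by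
  have hd := thetaSq_dissection (one_mul (1 : ℤ⟦X⟧))
  have hm := thetaSq_mul_thetaSq_neg
  have hs := thetaSq_sq
  have ht := thetaTri_sq
  have h4 := thetaSq_neg_pow_four
  have h0 := evenGen_mul
  set φ := thetaSq 1
  set μ := thetaSq (-1)
  set ψ := thetaTri
  obtain ⟨h1, -⟩ := dissect_mul_dilate (c := φ ^ 2) (d := 4 * dilate ψ ^ 2) (h0.trans (by
    simp only [map_mul, map_pow, map_ofNat]
    linear_combination hs))
  set g0 : ℤ⟦X⟧ := mk fun n => coeff (2 * n) evenGen with hg0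
  obtain ⟨-, h2⟩ := dissect_mul_dilate (f := g0) (m := μ ^ 2)
    (c := dilate φ ^ 3 + 12 * X * dilate φ * dilate (dilate ψ) ^ 2)
    (d := 6 * dilate φ ^ 2 * dilate (dilate ψ) + 8 * X * dilate (dilate ψ) ^ 3) (by
      simp only [map_mul, map_add, map_pow, map_ofNat, expand_X]
      rw [← hm]
      set x := dilate (dilate φ)
      set y := dilate (dilate (dilate ψ))
      have h1' : g0 * (φ * μ) = φ ^ 3 := by linear_combination φ * h1
      rw [h1']
      linear_combination (φ ^ 2 + φ * (x + 2 * X * y) + (x + 2 * X * y) ^ 2) * hd)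
  set g1 : ℤ⟦X⟧ := mk fun n => coeff (2 * n + 1) g0 with hg1
  obtain ⟨h3, -⟩ := dissect_mul_dilate (f := g1) (m := μ ^ 4)
    (c := 6 * φ ^ 4 * dilate ψ + 32 * X * dilate ψ ^ 5)
    (d := 32 * φ ^ 2 * dilate ψ ^ 3) (by
      simp only [map_mul, map_add, map_pow, map_ofNat, expand_X]
      set y := dilate (dilate ψ)
      have h2' : g1 * dilate μ ^ 4 =
          φ ^ 2 * (6 * dilate φ ^ 2 * y + 8 * X * y ^ 3) := by
        linear_combination φ ^ 2 * h2 - g1 * (φ * μ + dilate μ ^ 2) * hm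
      rw [h2', hs]
      ring)
  set g2 : ℤ⟦X⟧ := mk fun n => coeff (2 * n) g1 with hg2
  obtain ⟨h5, -⟩ := dissect_mul_dilate (f := g2) (m := μ ^ 8)
    (c := 6 * (φ ^ 8 + 96 * X * φ ^ 4 * dilate ψ ^ 4 + 256 * X ^ 2 * dilate ψ ^ 8) * ψ +
      256 * X * φ ^ 2 * dilate ψ ^ 2 * ψ ^ 5)
    (d := 6 * (16 * φ ^ 6 * dilate ψ ^ 2 + 256 * X * φ ^ 2 * dilate ψ ^ 6) * ψ +
      32 * (φ ^ 4 + 16 * X * dilate ψ ^ 4) * ψ ^ 5) (by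
      simp only [map_mul, map_add, map_pow, map_ofNat, expand_X]
      set y := dilate (dilate ψ)
      have hφ : φ ^ 4 = (dilate φ ^ 2 + 4 * X * y ^ 2) ^ 2 := by rw [← hs]; ring
      have h3' : g2 * dilate μ ^ 8 =
          φ ^ 4 * (6 * φ ^ 4 * dilate ψ + 32 * X * dilate ψ ^ 5) := by
        have hm4 : dilate μ ^ 8 = (φ * μ) ^ 4 := by rw [hm]; ring
        rw [hm4]
        linear_combination φ ^ 4 * h3
      rw [h3', hφ]
      ring)
  have hg3 : (mk fun n => coeff (2 * n) g2 : ℤ⟦X⟧) = v0Gen := by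
    ext n
    rw [coeff_mk, hg2, coeff_mk, hg1, coeff_mk, hg0, coeff_mk, v0Gen, coeff_mk,
      ← coeff_evenGen]
    congr 2
    ring
  rw [hg3] at h5
  rw [h5]
  have h6 : μ ^ 8 = (φ ^ 4 - 16 * X * dilate ψ ^ 4) ^ 2 := by rw [← h4]; ring
  have h7 : ψ ^ 8 = (φ * dilate ψ) ^ 4 := by rw [← ht]; ring
  have h8 : ψ ^ 4 = (φ * dilate ψ) ^ 2 := by rw [← ht]; ring
  rw [h6, h7]
  -- The constant 1024 is 6·128 + 256, where 128 = 96 + 32 comes from completing the square to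
  -- φ(-q)⁸.
  linear_combination 256 * X * φ ^ 2 * dilate ψ ^ 2 * ψ * h8

theorem eulerProd_pow_mul_v0Gen :
    eulerProd ^ 25 * (v0Gen - 6 * thetaTri) = 1024 * X * dilate eulerProd ^ 26 := by
  have h := v0Gen_mul
  have h1 : thetaSq (-1) ^ 8 * dilate eulerProd ^ 8 = eulerProd ^ 16 := by
    rw [← mul_pow, thetaSq_neg_mul_eulerProd]
    ring
  have h2 : thetaTri ^ 9 * eulerProd ^ 9 = dilate eulerProd ^ 18 := by
    rw [← mul_pow, thetaTri_mul_eulerProd]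
    ring
  linear_combination dilate eulerProd ^ 8 * eulerProd ^ 9 * h -
    eulerProd ^ 9 * (v0Gen - 6 * thetaTri) * h1 + 1024 * X * dilate eulerProd ^ 8 * h2

end Dissection

/-! ### Reduction modulo 25 and residues modulo 5. -/

section Congruence

theorem C_dvd_of_map_eq_zero {p : ℕ} {f : ℤ⟦X⟧} (h : map (Int.castRingHom (ZMod p)) f = 0) :
    (p : ℤ⟦X⟧) ∣ f := by
  have h1 (n : ℕ) : (p : ℤ) ∣ coeff n f := by
    rw [← ZMod.intCast_zmod_eq_zero_iff_dvd]
    simpa using congrArg (coeff n) h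
  choose g hg using h1
  refine ⟨mk g, ?_⟩
  ext n
  rw [hg, show (p : ℤ⟦X⟧) = C (p : ℤ) by simp, coeff_C_mul, coeff_mk]

theorem dvd_pow_five_sub_expand (f : ℤ⟦X⟧) :
    (5 : ℤ⟦X⟧) ∣ f ^ 5 - expand 5 (by norm_num) f := by
  have : Fact (Nat.Prime 5) := ⟨by norm_num⟩
  refine C_dvd_of_map_eq_zero (p := 5) ?_
  rw [map_sub, map_pow, map_expand, sub_eq_zero]
  have h := MvPowerSeries.map_frobenius_expand 5 (by norm_num)
    (f := (map (Int.castRingHom (ZMod 5)) f : MvPowerSeries Unit (ZMod 5)))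
  rw [ZMod.frobenius_zmod, MvPowerSeries.map_id] at h
  exact h.symm

theorem dvd_pow_sub_expand_pow (f : ℤ⟦X⟧) :
    (25 : ℤ⟦X⟧) ∣ f ^ 25 - expand 5 (by norm_num) f ^ 5 := by
  have h := dvd_sub_pow_of_dvd_sub (p := 5) (by exact_mod_cast dvd_pow_five_sub_expand f) 1
  rw [← pow_mul] at h
  norm_num at h
  exact h

theorem coeff_expand_five_mul {f g : ℤ⟦X⟧} {n : ℕ}
    (h : ∀ m, m % 5 = n % 5 → (25 : ℤ) ∣ coeff m g) :
    (25 : ℤ) ∣ coeff n (expand 5 (by norm_num) f * g) := by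
  rw [coeff_mul]
  refine Finset.dvd_sum fun p hp => ?_
  rw [Finset.HasAntidiagonal.mem_antidiagonal] at hp
  rw [coeff_expand]
  split_ifs with h5
  · exact Dvd.dvd.mul_left (h _ (by omega)) _
  · simp

theorem coeff_thetaTri_eq_zero {n : ℕ} (h : n % 5 = 2 ∨ n % 5 = 4) : coeff n thetaTri = 0 := by
  have h1 := (WithPiTopology.hasSum_iff_hasSum_coeff ℤ).1 hasSum_thetaTri n
  refine h1.unique (hasSum_zero.congr_fun fun k => ?_)
  rw [coeff_X_pow, if_neg]
  rintro rfl
  have h2 := two_mul_triangle k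
  have h3 : (k : ℤ) % 5 = 0 ∨ (k : ℤ) % 5 = 1 ∨ (k : ℤ) % 5 = 2 ∨ (k : ℤ) % 5 = 3 ∨
    (k : ℤ) % 5 = 4 := by omega
  have h4 : (2 * (triangle k : ℤ)) % 5 = ((k : ℤ) % 5 * (((k : ℤ) % 5 + 1) % 5)) % 5 := by
    rw [h2]
    simp [Int.mul_emod]
  rcases h3 with h3 | h3 | h3 | h3 | h3 <;> rw [h3] at h4 <;> omega

/-- Exponents here are 1 + k(3k-1), which is 0, 1 or 3 modulo 5. -/
theorem coeff_X_mul_dilate_eulerProd {n : ℕ} (h : n % 5 = 2 ∨ n % 5 = 4) :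
    coeff n (X * dilate eulerProd) = 0 := by
  cases n with
  | zero => simp
  | succ n =>
    rw [coeff_succ_X_mul, coeff_expand]
    split_ifs with h2
    · obtain ⟨j, rfl⟩ := h2
      rw [Nat.mul_div_cancel_left _ two_pos]
      apply coeff_pentagonalSeries_eq_zero
      rintro ⟨k, rfl⟩
      have h2 := two_mul_natCast_pentagonal k
      have h3 : k % 5 = 0 ∨ k % 5 = 1 ∨ k % 5 = 2 ∨ k % 5 = 3 ∨ k % 5 = 4 := by omega
      have h4 : (2 * (pentagonal k : ℤ)) % 5 = (k % 5 * ((3 * (k % 5) - 1) % 5)) % 5 := by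
        rw [h2]
        simp [Int.mul_emod, Int.sub_emod]
      rcases h3 with h3 | h3 | h3 | h3 | h3 <;> rw [h3] at h4 <;> omega
    · rfl

theorem dvd_coeff_v0Gen {n : ℕ} (h : n % 5 = 2 ∨ n % 5 = 4) : (25 : ℤ) ∣ coeff n v0Gen := by
  obtain ⟨a, ha⟩ := dvd_pow_sub_expand_pow eulerProd
  obtain ⟨b, hb⟩ := dvd_pow_sub_expand_pow (dilate eulerProd)
  set E : ℤ⟦X⟧ →ₐ[ℤ] ℤ⟦X⟧ := expand 5 (by norm_num)
  set v : ℤ⟦X⟧ := invOfUnit eulerProd 1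
  have hv : eulerProd * v = 1 := mul_invOfUnit _ _ (by simp [constantCoeff_eulerProd])
  have hE : E eulerProd ^ 5 * E v ^ 5 = 1 := by rw [← mul_pow, ← map_mul, hv, map_one, one_pow]
  -- E_1²⁵ and E_2²⁵ are replaced modulo 25 by fifth powers of series in q⁵; one factor E_2 of E_2²⁶
  -- is left over.
  have key : v0Gen - 6 * thetaTri =
      E (1024 * (dilate eulerProd * v) ^ 5) * (X * dilate eulerProd) +
      25 * (E v ^ 5 * (1024 * X * dilate eulerProd * b - a * (v0Gen - 6 * thetaTri))) := by
    simp only [map_mul, map_pow, map_ofNat]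
    linear_combination E v ^ 5 * eulerProd_pow_mul_v0Gen - (v0Gen - 6 * thetaTri) * hE
      - E v ^ 5 * (v0Gen - 6 * thetaTri) * ha + E v ^ 5 * 1024 * X * dilate eulerProd * hb
  have h1 : v0Gen = C 6 * thetaTri +
      E (1024 * (dilate eulerProd * v) ^ 5) * (X * dilate eulerProd) +
      C 25 * (E v ^ 5 * (1024 * X * dilate eulerProd * b - a * (v0Gen - 6 * thetaTri))) := by
    rw [map_ofNat, map_ofNat]
    linear_combination key
  rw [h1, map_add, map_add, coeff_C_mul, coeff_C_mul, coeff_thetaTri_eq_zero h]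
  refine dvd_add (dvd_add (by simp) (coeff_expand_five_mul fun m hm => ?_)) (dvd_mul_right _ _)
  rw [coeff_X_mul_dilate_eulerProd (by omega)]
  exact dvd_zero _

end Congruence

theorem mainTheorem8 (n : ℕ) :
    v0 (160 * n + 68) ≡ 0 [ZMOD 25] ∧ v0 (160 * n + 132) ≡ 0 [ZMOD 25] := by
  have h1 := dvd_coeff_v0Gen (n := 5 * n + 2) (by omega)
  have h2 := dvd_coeff_v0Gen (n := 5 * n + 4) (by omega)
  rw [v0Gen, coeff_mk] at h1 h2
  rw [show 32 * (5 * n + 2) + 4 = 160 * n + 68 by ring] at h1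
  rw [show 32 * (5 * n + 4) + 4 = 160 * n + 132 by ring] at h2
  rw [Int.modEq_zero_iff_dvd, Int.modEq_zero_iff_dvd]
  -- The factor 2 in `v0Gen` is invertible modulo 25.
  omega
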